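/- Let $k\ge 2$ be even, let $\mathbf u$ be the uniform distribution on $[k]=\{1,\dots,k\}$, let $\mathcal Y$ be a finite set and let $\mathcal W$ be a set of channels $W$ from $[k]$ to $\mathcal Y$, with transition probabilities $W(y\mid x)$. For a distribution $\mathbf p$ on $[k]$ put $W^{\mathbf p}(y)=\sum_x \mathbf p(x)W(y\mid x)$ and $\delta^W_{\mathbf p}(y)=(W^{\mathbf p}(y)-W^{\mathbf u}(y))/W^{\mathbf u}(y)$, and let $\langle \delta^W_{\mathbf p},\delta^W_{\mathbf p'}\rangle=\mathbb E_{Y\sim W^{\mathbf u}}[\delta^W_{\mathbf p}(Y)\,\delta^W_{\mathbf p'}(Y)]$. Let $H(W)$ be the $(k/2)\times(k/2)$ matrix $$H(W)_{i_1,i_2}=\sum_{y\in\mathcal Y}\frac{(W(y\mid 2i_1-1)-W(y\mid 2i_1))\,(W(y\mid 2i_2-1)-W(y\mid 2i_2))}{\sum_{x\in[k]}W(y\mid x)}$$ (with $0/0=0$), and let $\|\cdot\|_*$ be the nuclear norm (the sum of the singular values). An almost $\varepsilon$-perturbation (around $\mathbf u$) is a finite family $\mathcal P=\{\mathbf p_z\}_{z\in\mathcal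 Z}$ of distributions on $[k]$ together with a distribution $\zeta$ on $\mathcal Z$ such that $\Pr_{Z\sim\zeta}[d_{TV}(\mathbf p_Z,\mathbf u)\ge\varepsilon]\ge\alpha$ for some $\alpha\ge 1/10$; $\Upsilon_\varepsilon$ denotes the set of all of them. The $(n,\varepsilon)$-maxmin decoupled chi-square fluctuation of $\mathcal W$ is $$\underline\chi^{(2)}(\mathcal W^n,\varepsilon)=\sup_{(W_1,\dots,W_n)\in\mathcal W^n}\ \inf_{(\mathcal P,\zeta)\in\Upsilon_\varepsilon}\ \log \mathbb E_{Z,Z'}\exp\Big(\sum_{i=1}^n\langle\delta^{W_i}_{\mathbf p_Z},\delta^{W_i}_{\mathbf p_{Z'}}\rangle\Big),$$ where $Z,Z'$ are independent with law $\zeta$, and $\inf\emptyset=+\infty$. Theorem. There is a universal constant $C>0$, and for every $\varepsilon_0\in(0,1/2)$ a constant $K>0$ depending only on $\varepsilon_0$, such that for all $k$, $\mathcal Y$, $\mathcal W$ as above, all $n\in\mathbb N$ and all $\varepsilon\in(0,\varepsilon_0]$: whenever $$n\,\varepsilon^2\sup_{W\in\mathcal W}\|H(W)\|_*\le C\,k^{3/2},$$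 we have $$\underline\chi^{(2)}(\mathcal W^n,\varepsilon)\le K\cdot\frac{n^2\varepsilon^4}{k^3}\cdot\sup_{W\in\mathcal W}\|H(W)\|_*^2 .$$ In particular, for $\varepsilon\le 1/(12\sqrt2)$ both constants can be taken universal. -/

import Mathlib

namespace InformationConstraints

/-- Probability distributions on a finite alphabet. -/
abbrev Distribution (X : Type*) [Fintype X] : Type _ := stdSimplex ℝ X

/-- A channel with input alphabet `X` and finite output alphabet `Y`;
`W x y` is the transition probability `W(y | x)`. -/
abbrev Channel (X Y : Type*) [Fintype Y] : Type _ := X → Distribution Y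

section

variable {X Y : Type*} [Fintype X] [Fintype Y]

/-- Total variation distance. -/
noncomputable def tvDist (p q : Distribution X) : ℝ :=
  (1 / 2) * ∑ x, |p x - q x|

/-- The output distribution `W^p(y) = ∑ x, p(x) W(y | x)`. -/
noncomputable def outputProb (W : Channel X Y) (p : Distribution X) (y : Y) : ℝ :=
  ∑ x, p x * W x y

/-- The induced normalized perturbation `(W^p(y) - W^q(y)) / W^q(y)`. Where `W^q(y) = 0` the
value is irrelevant, since it is only used in expectations under `W^q`. -/
noncomputable def inducedPerturbation (W : Channel X Y) (q p : Distribution X) (y : Y) : ℝ :=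
  (outputProb W p y - outputProb W q y) / outputProb W q y

/-- The correlation `E_{Y ∼ W^q} [δ_p^W(Y) δ_{p'}^W(Y)]` of two induced perturbations. -/
noncomputable def inducedCorrelation (W : Channel X Y) (q p p' : Distribution X) : ℝ :=
  ∑ y, outputProb W q y * (inducedPerturbation W q p y * inducedPerturbation W q p' y)

end

/-- A pair `(P, ζ)` of a finite parametrized family `P = {p_z : z ∈ Z}` of distributions on `X`
and a distribution `ζ` on the parameter set `Z`. -/
structure WeightedFamily (X : Type*) [Fintype X] where
  /-- the parameter set -/
  Z : Type
  /-- the parameter set is finite -/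
  [fintypeZ : Fintype Z]
  /-- the distributions of the family -/
  p : Z → Distribution X
  /-- the law of the parameter -/
  ζ : Distribution Z

attribute [instance] WeightedFamily.fintypeZ

section

variable {X Y : Type*} [Fintype X] [Fintype Y]

/-- `(P, ζ)` is an almost `ε`-perturbation around `q`: for some `α ≥ 1/10`, a random `p_Z` with
`Z ∼ ζ` is at total variation distance at least `ε` from `q` with probability at least `α`. -/
def WeightedFamily.IsAlmostPerturbation (P : WeightedFamily X) (q : Distribution X)
    (ε : ℝ) : Prop :=
  ∃ α : ℝ, 1 / 10 ≤ α ∧ α ≤ ∑ z with ε ≤ tvDist (P.p z) q, P.ζ z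

/-- The induced decoupled chi-square fluctuation
`log E_{Z Z'} exp (∑ i, ⟨δ_Z^{W_i}, δ_{Z'}^{W_i}⟩)`, with `Z, Z'` independent of law `ζ`. -/
noncomputable def decoupledFluctuation (q : Distribution X) {n : ℕ} (W : Fin n → Channel X Y)
    (P : WeightedFamily X) : ℝ :=
  Real.log (∑ z, ∑ z', P.ζ z * P.ζ z' *
    Real.exp (∑ i, inducedCorrelation (W i) q (P.p z) (P.p z')))

/-- The `(n, ε)`-maxmin decoupled chi-square fluctuation of the family `𝒲` around `q`: supremum
over `n`-tuples of channels of `𝒲` of the infimum over all almost `ε`-perturbations around `q`.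
It is extended-real valued, so that the infimum over an empty set is `⊤`. -/
noncomputable def maxminFluctuation (q : Distribution X) (𝒲 : Set (Channel X Y)) (n : ℕ)
    (ε : ℝ) : EReal :=
  ⨆ W : Fin n → 𝒲, ⨅ P : WeightedFamily X, ⨅ _ : P.IsAlmostPerturbation q ε,
    (decoupledFluctuation q (fun i => (W i : Channel X Y)) P : EReal)

end

/-- The uniform distribution on `{0, …, k - 1}`. -/
noncomputable def uniform (k : ℕ) [NeZero k] : Distribution (Fin k) :=
  stdSimplex.barycenter

/-- The `k/2 × k/2` matrix `H(W)`. Inputs are numbered from `0`, so that the `i`-th pair of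
consecutive inputs is `(2i, 2i + 1)`. Outputs `y` of probability zero under every input
contribute `0`. -/
noncomputable def channelMatrix {k : ℕ} {Y : Type*} [Fintype Y] (W : Channel (Fin k) Y) :
    Matrix (Fin (k / 2)) (Fin (k / 2)) ℝ :=
  Matrix.of fun i j => ∑ y,
    ((W ⟨2 * i, by omega⟩ y - W ⟨2 * i + 1, by omega⟩ y) *
      (W ⟨2 * j, by omega⟩ y - W ⟨2 * j + 1, by omega⟩ y)) / ∑ x, W x y

/-- The nuclear norm of a real matrix: the sum of its singular values (Mathlib lists `n` of them
for a matrix with `n` columns, padded with zeros). -/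
noncomputable def nuclearNorm {m n : ℕ} (A : Matrix (Fin m) (Fin n) ℝ) : ℝ :=
  ∑ i : Fin n, (Matrix.toEuclideanLin A).singularValues i

/-- `sup_{W ∈ 𝒲} ‖H(W)‖_*`. All these norms lie in `[0, k]`, so the set is bounded. -/
noncomputable def supNuclearNorm {k : ℕ} {Y : Type*} [Fintype Y]
    (𝒲 : Set (Channel (Fin k) Y)) : ℝ :=
  ⨆ W : 𝒲, nuclearNorm (channelMatrix (W : Channel (Fin k) Y))

end InformationConstraints

open InformationConstraints

/-! Perturb the uniform distribution by `±β xᵢ / k` on the `i`-th pair of inputs, with `β = ε / ε₀`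
and `x` a random vector of `[-1, 1]^m`, `m = k / 2`. The exponent in the fluctuation is then `(β² /
k) ⟪T x, x'⟫` with `T = ∑ H(Wᵢ)`, a positive operator whose trace is at most `n sup ‖H‖_*`.

A trace bound does not control the norm of `T`, but by Markov's inequality for eigenvalues
(`exists_finrank_le_norm_apply_le`) `T` has norm `O(n sup ‖H‖_* / m)` off a subspace `Q` of
dimension at most `η m`. So `x` should avoid `Q`, be subgaussian, and still have `ℓ¹` norm at least
`2 ε₀ m` with constant probability. Such an `x` is the endpoint of a partial-colouring walk
(`exists_walk`, `exists_partialColoring`): small random sign steps, projected off `Q` and off the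
coordinates already close to `±1`. While many coordinates are alive the expected squared norm keeps
growing, yet it never exceeds `m`, so most coordinates must freeze.

Finally, with `x` fixed, the subgaussian bound in `x'` at `θ = (β² / k) T x` gives the decoupled
moment directly, quadratic in `‖T x‖` (`sum_sum_exp_inner_le`). -/

namespace InformationConstraints

open scoped InnerProductSpace
open Module

/-! ### Moments of uniform random signs -/

/-- The vector of signs encoded by a Boolean vector. -/
noncomputable def signVector {m : ℕ} (s : Fin m → Bool) : EuclideanSpace ℝ (Fin m) :=
  WithLp.toLp 2 fun i => if s i then 1 else -1

theorem signVector_apply {m : ℕ} (s : Fin m → Bool) (i : Fin m) :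
    signVector s i = if s i then 1 else -1 := rfl

theorem sum_prod_bool {m : ℕ} (f : Fin m → Bool → ℝ) :
    ∑ s : Fin m → Bool, ∏ i, f i (s i) = ∏ i, (f i true + f i false) := by
  rw [← Fintype.piFinset_univ, ← Finset.prod_univ_sum]
  simp

/-- By independence the average is `∏ cosh θᵢ`, and `cosh t ≤ exp (t² / 2)`. -/
theorem sum_exp_inner_signVector_le {m : ℕ} (θ : EuclideanSpace ℝ (Fin m)) :
    ∑ s : Fin m → Bool, Real.exp ⟪θ, signVector s⟫_ℝ ≤ 2 ^ m * Real.exp (‖θ‖ ^ 2 / 2) := by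
  have h : ∀ s : Fin m → Bool, Real.exp ⟪θ, signVector s⟫_ℝ =
      ∏ i, (fun (i : Fin m) (b : Bool) => Real.exp (θ i * if b then 1 else -1)) i (s i) := by
    intro s
    rw [← Real.exp_sum]
    simp [PiLp.inner_apply, signVector_apply, mul_comm]
  rw [Finset.sum_congr rfl fun s _ => h s, sum_prod_bool (fun i b => Real.exp (θ i * if b then 1 else -1))]
  calc ∏ i, (Real.exp (θ i * if true then 1 else -1) + Real.exp (θ i * if false then 1 else -1))
      = ∏ i, (2 * Real.cosh (θ i)) := by
        refine Finset.prod_congr rfl fun i _ => ?_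
        rw [Real.cosh_eq]; simp; ring
    _ ≤ ∏ i, (2 * Real.exp (θ i ^ 2 / 2)) := by
        refine Finset.prod_le_prod (fun i _ => by positivity) fun i _ => ?_
        gcongr
        exact Real.cosh_le_exp_half_sq _
    _ = 2 ^ m * Real.exp (‖θ‖ ^ 2 / 2) := by
        rw [Finset.prod_mul_distrib, ← Real.exp_sum, EuclideanSpace.real_norm_sq_eq,
          Finset.sum_div]
        simp

theorem sum_signVector_apply {m : ℕ} (i : Fin m) :
    ∑ s : Fin m → Bool, signVector s i = 0 := by
  have h : ∀ s : Fin m → Bool, signVector s i =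
      ∏ l, (fun (l : Fin m) (b : Bool) => if l = i then (if b then (1 : ℝ) else -1) else 1) l (s l) := by
    intro s
    simp [signVector_apply]
  rw [Finset.sum_congr rfl fun s _ => h s, sum_prod_bool (fun l b =>
    if l = i then (if b then (1 : ℝ) else -1) else 1)]
  exact Finset.prod_eq_zero (Finset.mem_univ i) (by simp)

theorem sum_signVector_mul {m : ℕ} (i j : Fin m) :
    ∑ s : Fin m → Bool, signVector s i * signVector s j = if i = j then 2 ^ m else 0 := by
  split_ifs with hij
  · subst hij
    have h : ∀ s : Fin m → Bool, signVector s i * signVector s i = 1 := by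
      intro s
      rw [signVector_apply]; split_ifs <;> norm_num
    simp [h]
  · have h : ∀ s : Fin m → Bool, signVector s i * signVector s j =
        ∏ l, (fun (l : Fin m) (b : Bool) => (if l = i then (if b then (1 : ℝ) else -1) else 1) *
          (if l = j then (if b then (1 : ℝ) else -1) else 1)) l (s l) := by
      intro s
      simp only [Finset.prod_mul_distrib, Finset.prod_ite_eq', Finset.mem_univ, if_true,
        signVector_apply]
    rw [Finset.sum_congr rfl fun s _ => h s, sum_prod_bool (fun l b =>
      (if l = i then (if b then (1 : ℝ) else -1) else 1) *
        (if l = j then (if b then (1 : ℝ) else -1) else 1))]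
    exact Finset.prod_eq_zero (Finset.mem_univ i) (by simp [hij])

theorem norm_sq_signVector {m : ℕ} (s : Fin m → Bool) : ‖signVector s‖ ^ 2 = m := by
  rw [EuclideanSpace.real_norm_sq_eq]
  have h : ∀ i : Fin m, signVector s i ^ 2 = 1 := by
    intro i
    rw [signVector_apply]; split_ifs <;> norm_num
  simp [h]

theorem sum_inner_signVector {m : ℕ} (θ : EuclideanSpace ℝ (Fin m)) :
    ∑ s : Fin m → Bool, ⟪θ, signVector s⟫_ℝ = 0 := by
  simp only [PiLp.inner_apply, RCLike.inner_apply, conj_trivial]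
  rw [Finset.sum_comm]
  refine Finset.sum_eq_zero fun i _ => ?_
  rw [← Finset.sum_mul, sum_signVector_apply, zero_mul]

theorem signVector_eq_sum {m : ℕ} (s : Fin m → Bool) :
    signVector s = ∑ i, signVector s i • EuclideanSpace.basisFun (Fin m) ℝ i := by
  conv_lhs => rw [← (EuclideanSpace.basisFun (Fin m) ℝ).sum_repr (signVector s)]
  simp

/-- Random signs have identity covariance, so the mean of `‖P s‖²` is the trace of the projection
`P`, which is its rank. -/
theorem sum_norm_sq_starProjection_signVector {m : ℕ}
    (V : Submodule ℝ (EuclideanSpace ℝ (Fin m))) :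
    ∑ s : Fin m → Bool, ‖V.starProjection (signVector s)‖ ^ 2 = 2 ^ m * finrank ℝ V := by
  set b := EuclideanSpace.basisFun (Fin m) ℝ
  have h1 : ∀ s : Fin m → Bool, ‖V.starProjection (signVector s)‖ ^ 2 =
      ∑ i, ∑ j, (signVector s i * signVector s j) * ⟪b i, V.starProjection (b j)⟫_ℝ := by
    intro s
    have : ‖V.starProjection (signVector s)‖ ^ 2 =
        ⟪signVector s, V.starProjection (signVector s)⟫_ℝ := by
      rw [← real_inner_self_eq_norm_sq, Submodule.inner_starProjection_left_eq_right,
        Submodule.starProjection_eq_self_iff.mpr (Submodule.starProjection_apply_mem V _)]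
    rw [this]
    conv_lhs => rw [signVector_eq_sum s]
    rw [map_sum, sum_inner]
    refine Finset.sum_congr rfl fun i _ => ?_
    rw [inner_sum]
    refine Finset.sum_congr rfl fun j _ => ?_
    rw [map_smul, inner_smul_left, inner_smul_right, conj_trivial, mul_assoc]
  simp_rw [h1]
  rw [Finset.sum_comm]
  have h2 : ∀ i : Fin m, ∑ s : Fin m → Bool, ∑ j, (signVector s i * signVector s j) *
      ⟪b i, V.starProjection (b j)⟫_ℝ = 2 ^ m * ⟪b i, V.starProjection (b i)⟫_ℝ := by
    intro i
    rw [Finset.sum_comm]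
    simp_rw [← Finset.sum_mul, sum_signVector_mul]
    simp
  simp_rw [h2]
  rw [← Finset.mul_sum]
  congr 1
  have h3 := LinearMap.trace_eq_sum_inner (V.starProjection : _ →ₗ[ℝ] _) b
  simp only [ContinuousLinearMap.coe_coe] at h3
  rw [← h3]
  have h4 : LinearMap.IsProj V (V.starProjection : EuclideanSpace ℝ (Fin m) →ₗ[ℝ] _) :=
    ⟨fun x => Submodule.starProjection_apply_mem V x,
      fun x hx => Submodule.starProjection_eq_self_iff.mpr hx⟩
  exact h4.trace

/-! ### The projected random walk in the cube -/

/-- The coordinates of `x` that have not yet come close to `±1`. -/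
noncomputable def aliveCoords {m : ℕ} (κ : ℝ) (x : EuclideanSpace ℝ (Fin m)) : Finset (Fin m) :=
  {i | |x i| < 1 - κ}

/-- The directions orthogonal to `Q` that do not move the coordinates which are not alive. -/
noncomputable def moveSpace {m : ℕ} (Q : Submodule ℝ (EuclideanSpace ℝ (Fin m))) (κ : ℝ)
    (x : EuclideanSpace ℝ (Fin m)) : Submodule ℝ (EuclideanSpace ℝ (Fin m)) :=
  (Q ⊔ Submodule.span ℝ
    (((aliveCoords κ x)ᶜ.image (EuclideanSpace.basisFun (Fin m) ℝ) : Finset _) : Set _))ᗮ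

theorem moveSpace_le {m : ℕ} (Q : Submodule ℝ (EuclideanSpace ℝ (Fin m))) (κ : ℝ)
    (x : EuclideanSpace ℝ (Fin m)) : moveSpace Q κ x ≤ Qᗮ :=
  Submodule.orthogonal_le le_sup_left

theorem apply_eq_zero_of_mem_moveSpace {m : ℕ} {Q : Submodule ℝ (EuclideanSpace ℝ (Fin m))}
    {κ : ℝ} {x v : EuclideanSpace ℝ (Fin m)} (hv : v ∈ moveSpace Q κ x) {i : Fin m}
    (hi : i ∉ aliveCoords κ x) : v i = 0 := by
  have h : EuclideanSpace.basisFun (Fin m) ℝ i ∈ Q ⊔ Submodule.span ℝ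
      (((aliveCoords κ x)ᶜ.image (EuclideanSpace.basisFun (Fin m) ℝ) : Finset _) : Set _) := by
    refine Submodule.mem_sup_right (Submodule.subset_span ?_)
    exact Finset.mem_coe.mpr (Finset.mem_image_of_mem _ (by simpa using hi))
  have := hv _ h
  rwa [EuclideanSpace.basisFun_inner] at this

/-- Dimension count: being orthogonal to `Q` and to each frozen basis vector costs at most `dim Q`
plus the number of frozen coordinates. -/
theorem card_aliveCoords_le {m : ℕ} (Q : Submodule ℝ (EuclideanSpace ℝ (Fin m))) (κ : ℝ)
    (x : EuclideanSpace ℝ (Fin m)) :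
    (aliveCoords κ x).card ≤ finrank ℝ Q + finrank ℝ (moveSpace Q κ x) := by
  have h1 := Submodule.finrank_add_finrank_orthogonal (Q ⊔ Submodule.span ℝ
    (((aliveCoords κ x)ᶜ.image (EuclideanSpace.basisFun (Fin m) ℝ) : Finset _) : Set _))
  have h2 := Submodule.finrank_add_le_finrank_add_finrank Q (Submodule.span ℝ
    (((aliveCoords κ x)ᶜ.image (EuclideanSpace.basisFun (Fin m) ℝ) : Finset _) : Set _))
  have h3 := finrank_span_finset_le_card (R := ℝ)
    ((aliveCoords κ x)ᶜ.image (EuclideanSpace.basisFun (Fin m) ℝ))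
  have h4 := Finset.card_image_le (s := (aliveCoords κ x)ᶜ)
    (f := (EuclideanSpace.basisFun (Fin m) ℝ))
  have h5 := Finset.card_add_card_compl (aliveCoords κ x)
  rw [finrank_euclideanSpace] at h1
  rw [Set.finrank] at h3
  change _ + finrank ℝ (moveSpace Q κ x) = _ at h1
  omega

theorem abs_apply_le_norm {m : ℕ} (v : EuclideanSpace ℝ (Fin m)) (i : Fin m) : |v i| ≤ ‖v‖ := by
  simpa using PiLp.norm_apply_le v i

/-- A finite random walk inside `[-1, 1]^m ∩ Qᗮ` with uniformly subgaussian endpoint, whose energy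
grows as long as many coordinates are alive. -/
theorem exists_walk {m : ℕ} (Q : Submodule ℝ (EuclideanSpace ℝ (Fin m))) {γ κ d r : ℝ}
    (hγ : 0 ≤ γ) (hκ : γ * √m ≤ κ) (hd : 0 ≤ d) (hr : d + finrank ℝ Q ≤ r) (N : ℕ) :
    ∃ (Z : Type) (_ : Fintype Z) (w : Z → ℝ) (x : Z → EuclideanSpace ℝ (Fin m)),
      (∀ z, 0 ≤ w z) ∧ ∑ z, w z = 1 ∧ (∀ z, x z ∈ Qᗮ) ∧ (∀ z i, |x z i| ≤ 1) ∧
      (∀ θ : EuclideanSpace ℝ (Fin m),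
        ∑ z, w z * Real.exp ⟪θ, x z⟫_ℝ ≤ Real.exp (N * γ ^ 2 * ‖θ‖ ^ 2 / 2)) ∧
      N * γ ^ 2 * d * ∑ z, w z * (if r ≤ (aliveCoords κ (x z)).card then 1 else 0) ≤
        ∑ z, w z * ‖x z‖ ^ 2 := by
  induction N with
  | zero =>
    refine ⟨Unit, inferInstance, fun _ => 1, fun _ => 0, ?_, ?_, ?_, ?_, ?_, ?_⟩ <;> simp
  | succ N ih =>
    obtain ⟨Z, _, w, x, hw, hw1, hxQ, hx1, hexp, hen⟩ := ih
    set P := fun z => (moveSpace Q κ (x z)).starProjection with hP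
    have hPmem : ∀ z v, P z v ∈ moveSpace Q κ (x z) := fun z v =>
      Submodule.starProjection_apply_mem _ v
    have hPnorm : ∀ z v, ‖P z v‖ ≤ ‖v‖ := fun z v => Submodule.norm_starProjection_apply_le _ v
    have hPinner : ∀ z u v, ⟪u, P z v⟫_ℝ = ⟪P z u, v⟫_ℝ := fun z u v =>
      (Submodule.inner_starProjection_left_eq_right _ u v).symm
    have h2 : (0 : ℝ) < 2 ^ m := by positivity
    -- A sign vector has norm `√m` and projections contract, so one step moves a coordinate by at
    -- most `γ √m ≤ κ`; an alive coordinate cannot leave `[-1, 1]`.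
    have hinc : ∀ z (s : Fin m → Bool) i, |γ * P z (signVector s) i| ≤ κ := by
      intro z s i
      rw [abs_mul, abs_of_nonneg hγ]
      refine le_trans (mul_le_mul_of_nonneg_left ?_ hγ) hκ
      refine (abs_apply_le_norm _ i).trans ((hPnorm z _).trans ?_)
      exact Real.le_sqrt_of_sq_le (norm_sq_signVector s).le
    have hfix : ∀ z (s : Fin m → Bool) i, i ∉ aliveCoords κ (x z) →
        P z (signVector s) i = 0 := fun z s i hi => apply_eq_zero_of_mem_moveSpace (hPmem z _) hi
    refine ⟨Z × (Fin m → Bool), inferInstance, fun a => w a.1 / 2 ^ m,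
      fun a => x a.1 + γ • P a.1 (signVector a.2), ?_, ?_, ?_, ?_, ?_, ?_⟩
    · intro a
      have := hw a.1
      positivity
    · rw [Fintype.sum_prod_type]
      simp only [Finset.sum_const, Finset.card_univ, Fintype.card_fun, Fintype.card_bool,
        Fintype.card_fin, nsmul_eq_mul, Nat.cast_pow, Nat.cast_ofNat]
      rw [← hw1]
      refine Finset.sum_congr rfl fun z _ => by field_simp
    · intro a
      exact Submodule.add_mem _ (hxQ _) (Submodule.smul_mem _ _ (moveSpace_le _ _ _ (hPmem _ _)))
    · intro a i
      simp only [PiLp.add_apply, PiLp.smul_apply, smul_eq_mul]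
      by_cases hi : i ∈ aliveCoords κ (x a.1)
      · have h3 : |x a.1 i| < 1 - κ := by simpa [aliveCoords] using hi
        have := abs_add_le (x a.1 i) (γ * P a.1 (signVector a.2) i)
        linarith [hinc a.1 a.2 i]
      · rw [hfix _ _ _ hi]
        simpa using hx1 a.1 i
    · intro θ
      rw [Fintype.sum_prod_type]
      -- Condition on the current position: `P` is self-adjoint, so it passes to `θ`, and `‖P θ‖ ≤
      -- ‖θ‖` makes the cost of a step independent of the position.
      calc ∑ z, ∑ s : Fin m → Bool,
            w z / 2 ^ m * Real.exp ⟪θ, x z + γ • P z (signVector s)⟫_ℝ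
          = ∑ z, w z / 2 ^ m * Real.exp ⟪θ, x z⟫_ℝ *
              ∑ s : Fin m → Bool, Real.exp ⟪γ • P z θ, signVector s⟫_ℝ := by
            refine Finset.sum_congr rfl fun z _ => ?_
            rw [Finset.mul_sum]
            refine Finset.sum_congr rfl fun s _ => ?_
            rw [inner_add_right, inner_smul_right, hPinner, inner_smul_left, Real.exp_add]
            simp only [conj_trivial]
            ring
        _ ≤ ∑ z, w z / 2 ^ m * Real.exp ⟪θ, x z⟫_ℝ *
              (2 ^ m * Real.exp (γ ^ 2 * ‖θ‖ ^ 2 / 2)) := by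
            refine Finset.sum_le_sum fun z _ => ?_
            have := hw z
            refine mul_le_mul_of_nonneg_left ?_ (by positivity)
            refine (sum_exp_inner_signVector_le _).trans ?_
            rw [norm_smul, mul_pow, Real.norm_eq_abs, sq_abs]
            gcongr
            exact hPnorm z θ
        _ = (∑ z, w z * Real.exp ⟪θ, x z⟫_ℝ) * Real.exp (γ ^ 2 * ‖θ‖ ^ 2 / 2) := by
            rw [Finset.sum_mul]
            refine Finset.sum_congr rfl fun z _ => by field_simp
        _ ≤ Real.exp (N * γ ^ 2 * ‖θ‖ ^ 2 / 2) * Real.exp (γ ^ 2 * ‖θ‖ ^ 2 / 2) := by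
            gcongr
            exact hexp θ
        _ = _ := by
            rw [← Real.exp_add]
            push_cast
            ring_nf
    · rw [Fintype.sum_prod_type, Fintype.sum_prod_type]
      set act : EuclideanSpace ℝ (Fin m) → ℝ :=
        fun v => if r ≤ (aliveCoords κ v).card then 1 else 0 with hact
      -- Frozen coordinates never move again, so the alive set only shrinks.
      have hmono : ∀ z (s : Fin m → Bool), act (x z + γ • P z (signVector s)) ≤ act (x z) := by
        intro z s
        have hsub : aliveCoords κ (x z + γ • P z (signVector s)) ⊆ aliveCoords κ (x z) := by
          intro i hi
          by_contra hni
          have h3 := hfix z s i hni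
          have h4 := (Finset.mem_filter.mp hi).2
          rw [PiLp.add_apply, PiLp.smul_apply, h3, smul_zero, add_zero] at h4
          exact hni (Finset.mem_filter.mpr ⟨Finset.mem_univ i, h4⟩)
        have hcard : ((aliveCoords κ (x z + γ • P z (signVector s))).card : ℝ) ≤
            (aliveCoords κ (x z)).card := by exact_mod_cast Finset.card_le_card hsub
        simp only [hact]
        split_ifs <;> linarith
      -- The cross term averages to zero, so the mean energy gain is `γ²` times the dimension of the
      -- move space, at least `d` while `r` or more coordinates are alive.
      have hener : ∀ z, w z * ‖x z‖ ^ 2 + w z * (γ ^ 2 * d * act (x z)) ≤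
          ∑ s : Fin m → Bool, w z / 2 ^ m * ‖x z + γ • P z (signVector s)‖ ^ 2 := by
        intro z
        have e1 : ∑ s : Fin m → Bool, w z / 2 ^ m * ‖x z + γ • P z (signVector s)‖ ^ 2 =
            w z * ‖x z‖ ^ 2 + w z * (γ ^ 2 * finrank ℝ (moveSpace Q κ (x z))) := by
          have e2 : ∀ s : Fin m → Bool, w z / 2 ^ m * ‖x z + γ • P z (signVector s)‖ ^ 2 =
              w z / 2 ^ m * ‖x z‖ ^ 2 + w z / 2 ^ m * (2 * γ) * ⟪P z (x z), signVector s⟫_ℝ +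
              w z / 2 ^ m * γ ^ 2 * ‖P z (signVector s)‖ ^ 2 := by
            intro s
            rw [norm_add_sq_real, inner_smul_right, hPinner, norm_smul, mul_pow, Real.norm_eq_abs,
              sq_abs]
            ring
          simp_rw [e2]
          rw [Finset.sum_add_distrib, Finset.sum_add_distrib, ← Finset.mul_sum, ← Finset.mul_sum,
            ← Finset.mul_sum, sum_inner_signVector, sum_norm_sq_starProjection_signVector]
          simp only [Finset.sum_const, Finset.card_univ, Fintype.card_fun, Fintype.card_bool,
            Fintype.card_fin, nsmul_eq_mul, Nat.cast_pow, Nat.cast_ofNat]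
          field_simp
          ring
        rw [e1]
        have hdim : d * act (x z) ≤ finrank ℝ (moveSpace Q κ (x z)) := by
          simp only [hact]
          split_ifs with h
          · have : ((aliveCoords κ (x z)).card : ℝ) ≤
                finrank ℝ Q + finrank ℝ (moveSpace Q κ (x z)) := by
              exact_mod_cast card_aliveCoords_le Q κ (x z)
            linarith
          · simp
        have := hw z
        rw [mul_assoc (γ ^ 2)]
        gcongr
      have hsum : ∑ z, ∑ s : Fin m → Bool, w z / 2 ^ m * act (x z + γ • P z (signVector s)) ≤
          ∑ z, w z * act (x z) := by
        refine Finset.sum_le_sum fun z _ => ?_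
        calc _ ≤ ∑ s : Fin m → Bool, w z / 2 ^ m * act (x z) := by
              refine Finset.sum_le_sum fun s _ => ?_
              have := hw z
              exact mul_le_mul_of_nonneg_left (hmono z s) (by positivity)
          _ = _ := by
              simp only [Finset.sum_const, Finset.card_univ, Fintype.card_fun, Fintype.card_bool,
                Fintype.card_fin, nsmul_eq_mul, Nat.cast_pow, Nat.cast_ofNat]
              field_simp
      -- By monotonicity the new activity is at most the old one; `N` copies of the latter go to the
      -- induction hypothesis and the last one to the new step.
      calc _ ≤ ((N + 1 : ℕ) : ℝ) * γ ^ 2 * d * ∑ z, w z * act (x z) := by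
            exact mul_le_mul_of_nonneg_left hsum (by positivity)
        _ = N * γ ^ 2 * d * (∑ z, w z * act (x z)) + ∑ z, w z * (γ ^ 2 * d * act (x z)) := by
            have : ∑ z, w z * (γ ^ 2 * d * act (x z)) = γ ^ 2 * d * ∑ z, w z * act (x z) := by
              rw [Finset.mul_sum]
              exact Finset.sum_congr rfl fun z _ => by ring
            rw [this]
            push_cast
            ring
        _ ≤ ∑ z, w z * ‖x z‖ ^ 2 + ∑ z, w z * (γ ^ 2 * d * act (x z)) := by gcongr
        _ ≤ _ := by
            rw [← Finset.sum_add_distrib]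
            exact Finset.sum_le_sum fun z _ => hener z

/-! ### Removing the large eigenvalues -/

/-- A positive operator of trace at most `t` is bounded by `t / r` outside a subspace of dimension
at most `r`. -/
theorem exists_finrank_le_norm_apply_le {E : Type*} [NormedAddCommGroup E] [InnerProductSpace ℝ E]
    [FiniteDimensional ℝ E] {T : E →ₗ[ℝ] E} (hT : T.IsPositive) {t r : ℝ}
    (ht : LinearMap.trace ℝ E T ≤ t) (hr : 0 < r) :
    ∃ Q : Submodule ℝ E, (finrank ℝ Q : ℝ) ≤ r ∧ ∀ x ∈ Qᗮ, ‖T x‖ ≤ t / r * ‖x‖ := by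
  classical
  set b := hT.isSymmetric.eigenvectorBasis rfl with hb
  set μ := hT.isSymmetric.eigenvalues rfl with hμ
  have hTb : ∀ i, T (b i) = μ i • b i := fun i => hT.isSymmetric.apply_eigenvectorBasis rfl i
  have hμ0 : ∀ i, 0 ≤ μ i := fun i => hT.nonneg_eigenvalues rfl i
  have htr : LinearMap.trace ℝ E T = ∑ i, μ i := by
    rw [LinearMap.trace_eq_sum_inner T b]
    refine Finset.sum_congr rfl fun i _ => ?_
    rw [hTb, inner_smul_right, real_inner_self_eq_norm_sq, b.norm_eq_one]
    ring
  rw [htr] at ht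
  have ht0 : 0 ≤ t := (Finset.sum_nonneg fun i _ => hμ0 i).trans ht
  -- `Q` is spanned by the eigenvectors of eigenvalue above `t / r`; positivity and the trace bound
  -- leave at most `r` of them.
  set I : Finset (Fin (finrank ℝ E)) := {i | t / r < μ i} with hI
  refine ⟨Submodule.span ℝ ((I.image b : Finset E) : Set E), ?_, ?_⟩
  · have h1 : finrank ℝ (Submodule.span ℝ ((I.image b : Finset E) : Set E)) ≤ I.card :=
      (finrank_span_finset_le_card _).trans Finset.card_image_le
    refine (Nat.cast_le.mpr h1).trans ?_
    rcases I.eq_empty_or_nonempty with h | h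
    · simp [h, hr.le]
    · have h2 : (I.card : ℝ) * (t / r) < t := by
        calc (I.card : ℝ) * (t / r) = ∑ i ∈ I, t / r := by simp
          _ < ∑ i ∈ I, μ i := Finset.sum_lt_sum_of_nonempty h fun i hi => by simpa [hI] using hi
          _ ≤ ∑ i, μ i := Finset.sum_le_sum_of_subset_of_nonneg (Finset.subset_univ _)
              fun i _ _ => hμ0 i
          _ ≤ t := ht
      rcases ht0.eq_or_lt with h0 | h0
      · rw [← h0] at h2; simp at h2
      · rw [mul_div_assoc', div_lt_iff₀ hr, mul_comm] at h2
        exact (lt_of_mul_lt_mul_left h2 h0.le).le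
  · intro x hx
    have hc : ∀ i, ⟪b i, T x⟫_ℝ = μ i * ⟪b i, x⟫_ℝ := by
      intro i
      rw [← hT.isSymmetric, hTb, inner_smul_left, conj_trivial]
    have hle : ∀ i, ⟪b i, T x⟫_ℝ ^ 2 ≤ (t / r) ^ 2 * ⟪b i, x⟫_ℝ ^ 2 := by
      intro i
      rw [hc, mul_pow]
      by_cases hi : i ∈ I
      · have : ⟪b i, x⟫_ℝ = 0 :=
          hx _ (Submodule.subset_span (Finset.mem_coe.mpr (Finset.mem_image_of_mem _ hi)))
        simp [this]
      · have : μ i ≤ t / r := by simpa [hI] using hi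
        have := hμ0 i
        gcongr
    have hsq : ‖T x‖ ^ 2 ≤ (t / r * ‖x‖) ^ 2 := by
      rw [mul_pow, ← b.sum_sq_inner_right (T x), ← b.sum_sq_inner_right x, Finset.mul_sum]
      exact Finset.sum_le_sum fun i _ => hle i
    exact le_of_sq_le_sq hsq (by positivity)

/-! ### Partial colouring and the decoupled moment -/

theorem norm_sq_le_of_abs_le_one {m : ℕ} {x : EuclideanSpace ℝ (Fin m)} (hx : ∀ i, |x i| ≤ 1) :
    ‖x‖ ^ 2 ≤ m := by
  rw [EuclideanSpace.real_norm_sq_eq]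
  calc ∑ i, x i ^ 2 ≤ ∑ _i : Fin m, (1 : ℝ) :=
        Finset.sum_le_sum fun i _ => (sq_le_one_iff_abs_le_one _).mpr (hx i)
    _ = m := by simp

/-- Random partial colouring: a random vector of the cube `[-1, 1]^m`, orthogonal to a given
subspace of small dimension, subgaussian, and of large `ℓ¹` norm with probability at least
`1 / 10`. -/
theorem exists_partialColoring {m : ℕ} (hm : 0 < m) {η : ℝ} (hη : 0 < η) (hη3 : η < 1 / 3)
    (Q : Submodule ℝ (EuclideanSpace ℝ (Fin m))) (hQ : (finrank ℝ Q : ℝ) ≤ η * m) :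
    ∃ (Z : Type) (_ : Fintype Z) (w : Z → ℝ) (x : Z → EuclideanSpace ℝ (Fin m)),
      (∀ z, 0 ≤ w z) ∧ ∑ z, w z = 1 ∧ (∀ z, x z ∈ Qᗮ) ∧ (∀ z i, |x z i| ≤ 1) ∧
      (∀ θ : EuclideanSpace ℝ (Fin m),
        ∑ z, w z * Real.exp ⟪θ, x z⟫_ℝ ≤ Real.exp (1 / η * ‖θ‖ ^ 2)) ∧
      1 / 10 ≤ ∑ z with (1 - 3 * η) * m ≤ ∑ i, |x z i|, w z := by
  have hm' : (1 : ℝ) ≤ m := by exact_mod_cast hm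
  set γ : ℝ := η / √m with hγdef
  have hγ : 0 < γ := by positivity
  have hγsq : γ ^ 2 ≤ η ^ 2 := by
    rw [hγdef, div_pow, Real.sq_sqrt (by positivity)]
    exact div_le_self (by positivity) hm'
  -- This puts the total time `N γ²` in `[3 / (2η), 2 / η]`: long enough to force freezing, short
  -- enough for the subgaussian constant `1 / η`. The rounding error `γ² ≤ η²` fits because `η < 1 /
  -- 3`.
  set N : ℕ := ⌈3 / (2 * η) / γ ^ 2⌉₊ with hN
  have hN1 : 3 / (2 * η) ≤ N * γ ^ 2 := by
    rw [← div_le_iff₀ (by positivity)]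
    exact Nat.le_ceil _
  have hN2 : N * γ ^ 2 ≤ 2 / η := by
    have h1 : (N : ℝ) ≤ 3 / (2 * η) / γ ^ 2 + 1 := (Nat.ceil_lt_add_one (by positivity)).le
    have h2 : N * γ ^ 2 ≤ 3 / (2 * η) + γ ^ 2 := by
      refine (mul_le_mul_of_nonneg_right h1 (by positivity)).trans_eq ?_
      field_simp
    have h3 : 3 / (2 * η) + η ^ 2 ≤ 2 / η := by
      rw [div_add' _ _ _ (by positivity), div_le_div_iff₀ (by positivity) hη]
      have : η ^ 3 ≤ (1 / 3) ^ 3 := by gcongr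
      nlinarith
    linarith
  obtain ⟨Z, hZ, w, x, hw, hw1, hxQ, hx1, hexp, hen⟩ := exists_walk Q (γ := γ) (κ := η)
    (d := η * m) (r := 2 * η * m) hγ.le (by rw [hγdef]; field_simp; rfl) (by positivity)
    (by linarith) N
  refine ⟨Z, hZ, w, x, hw, hw1, hxQ, hx1, fun θ => (hexp θ).trans ?_, ?_⟩
  · refine Real.exp_le_exp.mpr ?_
    have := mul_le_mul_of_nonneg_right hN2 (sq_nonneg ‖θ‖)
    calc _ ≤ 2 / η * ‖θ‖ ^ 2 / 2 := by linarith
      _ = _ := by ring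
  · have hE : ∑ z, w z * ‖x z‖ ^ 2 ≤ m := by
      calc _ ≤ ∑ z, w z * m := Finset.sum_le_sum fun z _ =>
            mul_le_mul_of_nonneg_left (norm_sq_le_of_abs_le_one (hx1 z)) (hw z)
        _ = m := by rw [← Finset.sum_mul, hw1, one_mul]
    set a := ∑ z, w z * (if 2 * η * m ≤ (aliveCoords η (x z)).card then (1 : ℝ) else 0) with ha
    have ha0 : 0 ≤ a := Finset.sum_nonneg fun z _ => mul_nonneg (hw z) (by split_ifs <;> norm_num)
    -- Energy gained at rate `η m` for time `3 / (2η)` is `3m / 2`, against a ceiling of `m`.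
    have hale : a ≤ 2 / 3 := by
      have h1 : 3 / (2 * η) * (η * m) * a ≤ m := by
        refine le_trans ?_ (hen.trans hE)
        gcongr
      have h2 : 3 / (2 * η) * (η * m) * a = m * (3 / 2 * a) := by field_simp
      rw [h2] at h1
      have := (mul_le_iff_le_one_right (by positivity : (0 : ℝ) < m)).mp h1
      linarith
    have hgood : ∀ z, w z - w z * (if 2 * η * m ≤ (aliveCoords η (x z)).card then (1 : ℝ) else 0) ≤
        if (1 - 3 * η) * m ≤ ∑ i, |x z i| then w z else 0 := by
      intro z
      by_cases h : 2 * η * m ≤ (aliveCoords η (x z)).card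
      · rw [if_pos h]
        split_ifs
        · linarith [hw z]
        · linarith
      · rw [if_neg h, if_pos]
        · linarith
        -- More than `(1 - 2η) m` coordinates have modulus at least `1 - η`, and `(1 - 2η)(1 - η) ≥
        -- 1 - 3η`.
        · have h1 : ∑ i, |x z i| ≥ ((aliveCoords η (x z))ᶜ).card * (1 - η) := by
            calc ((aliveCoords η (x z))ᶜ).card * (1 - η) = ∑ i ∈ (aliveCoords η (x z))ᶜ, (1 - η) := by
                  rw [Finset.sum_const, nsmul_eq_mul]
              _ ≤ ∑ i ∈ (aliveCoords η (x z))ᶜ, |x z i| := by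
                  refine Finset.sum_le_sum fun i hi => ?_
                  simpa [aliveCoords] using hi
              _ ≤ _ := Finset.sum_le_sum_of_subset_of_nonneg (Finset.subset_univ _)
                  fun i _ _ => abs_nonneg _
          have h2 : ((aliveCoords η (x z)).card : ℝ) + ((aliveCoords η (x z))ᶜ).card = m := by
            have := Finset.card_add_card_compl (aliveCoords η (x z))
            rw [Fintype.card_fin] at this
            exact_mod_cast this
          push Not at h
          have h3 : (1 - 2 * η) * m * (1 - η) ≤ ((aliveCoords η (x z))ᶜ).card * (1 - η) := by
            refine mul_le_mul_of_nonneg_right ?_ (by linarith)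
            linarith
          have h4 : 0 ≤ η ^ 2 * m := by positivity
          nlinarith
    rw [Finset.sum_filter]
    calc (1 : ℝ) / 10 ≤ 1 - a := by linarith
      _ = ∑ z, (w z - w z * (if 2 * η * m ≤ (aliveCoords η (x z)).card then (1 : ℝ) else 0)) := by
          rw [Finset.sum_sub_distrib, hw1]
      _ ≤ _ := Finset.sum_le_sum fun z _ => hgood z

/-- The decoupled exponential moment of a quadratic form on a subgaussian random vector of the
cube. -/
theorem sum_sum_exp_inner_le {m : ℕ} {Z : Type*} [Fintype Z] {w : Z → ℝ}
    {x : Z → EuclideanSpace ℝ (Fin m)} {T : EuclideanSpace ℝ (Fin m) →ₗ[ℝ] EuclideanSpace ℝ (Fin m)}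
    {σ c l : ℝ} (hσ : 0 ≤ σ) (hw : ∀ z, 0 ≤ w z) (hw1 : ∑ z, w z = 1) (hx1 : ∀ z i, |x z i| ≤ 1)
    (hexp : ∀ θ : EuclideanSpace ℝ (Fin m),
        ∑ z, w z * Real.exp ⟪θ, x z⟫_ℝ ≤ Real.exp (σ * ‖θ‖ ^ 2))
    (hT : ∀ z, ‖T (x z)‖ ≤ c * ‖x z‖) :
    ∑ z, ∑ z', w z * w z' * Real.exp (l * ⟪T (x z), x z'⟫_ℝ) ≤
      Real.exp (σ * l ^ 2 * c ^ 2 * m) := by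
  calc ∑ z, ∑ z', w z * w z' * Real.exp (l * ⟪T (x z), x z'⟫_ℝ)
      = ∑ z, w z * ∑ z', w z' * Real.exp ⟪l • T (x z), x z'⟫_ℝ := by
        refine Finset.sum_congr rfl fun z _ => ?_
        rw [Finset.mul_sum]
        refine Finset.sum_congr rfl fun z' _ => ?_
        rw [inner_smul_left, conj_trivial, mul_assoc]
    _ ≤ ∑ z, w z * Real.exp (σ * l ^ 2 * c ^ 2 * m) := by
        refine Finset.sum_le_sum fun z _ => mul_le_mul_of_nonneg_left ?_ (hw z)
        refine (hexp _).trans (Real.exp_le_exp.mpr ?_)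
        have h1 : ‖l • T (x z)‖ ^ 2 ≤ l ^ 2 * (c ^ 2 * m) := by
          rw [norm_smul, mul_pow, Real.norm_eq_abs, sq_abs]
          refine mul_le_mul_of_nonneg_left ?_ (sq_nonneg _)
          calc ‖T (x z)‖ ^ 2 ≤ (c * ‖x z‖) ^ 2 := pow_le_pow_left₀ (norm_nonneg _) (hT z) 2
            _ = c ^ 2 * ‖x z‖ ^ 2 := mul_pow _ _ _
            _ ≤ _ := mul_le_mul_of_nonneg_left (norm_sq_le_of_abs_le_one (hx1 z)) (sq_nonneg _)
        calc _ ≤ σ * (l ^ 2 * (c ^ 2 * m)) := mul_le_mul_of_nonneg_left h1 hσ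
          _ = _ := by ring
    _ = _ := by rw [← Finset.sum_mul, hw1, one_mul]

/-! ### Trace and nuclear norm -/

theorem singularValues_eq_norm_apply {E F : Type*} [NormedAddCommGroup E] [InnerProductSpace ℝ E]
    [FiniteDimensional ℝ E] [NormedAddCommGroup F] [InnerProductSpace ℝ F] [FiniteDimensional ℝ F]
    (T : E →ₗ[ℝ] F) {n : ℕ} (hn : finrank ℝ E = n) (i : Fin n) :
    T.singularValues i = ‖T (T.isSymmetric_adjoint_comp_self.eigenvectorBasis hn i)‖ := by
  rw [T.singularValues_fin hn, ← Real.sqrt_sq (norm_nonneg _)]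
  congr 1
  set b := T.isSymmetric_adjoint_comp_self.eigenvectorBasis hn with hb
  have h := T.isSymmetric_adjoint_comp_self.apply_eigenvectorBasis hn i
  rw [← hb] at h
  rw [← real_inner_self_eq_norm_sq, ← LinearMap.adjoint_inner_right, ← LinearMap.comp_apply, h]
  simp [inner_smul_right]

/-- In an orthonormal basis of right singular vectors, each diagonal entry `⟪b i, T (b i)⟫` is at
most `‖T (b i)‖`, a singular value. -/
theorem trace_toEuclideanLin_le_nuclearNorm {m : ℕ} (A : Matrix (Fin m) (Fin m) ℝ) :
    LinearMap.trace ℝ _ (Matrix.toEuclideanLin A) ≤ nuclearNorm A := by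
  set T := Matrix.toEuclideanLin A
  have hn : finrank ℝ (EuclideanSpace ℝ (Fin m)) = m := by simp
  set b := T.isSymmetric_adjoint_comp_self.eigenvectorBasis hn with hb
  rw [LinearMap.trace_eq_sum_inner T b, nuclearNorm]
  refine Finset.sum_le_sum fun i _ => ?_
  rw [singularValues_eq_norm_apply T hn i]
  refine (real_inner_le_norm _ _).trans ?_
  rw [b.norm_eq_one, one_mul]

/-- A crude bound, needed only to make the supremum over channels a supremum of a bounded set. -/
theorem nuclearNorm_le_of_abs_le {m n : ℕ} {A : Matrix (Fin m) (Fin n) ℝ} {c : ℝ}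
    (hA : ∀ i j, |A i j| ≤ c) : nuclearNorm A ≤ n * (m * (n * c)) := by
  set T := Matrix.toEuclideanLin A
  have hn : finrank ℝ (EuclideanSpace ℝ (Fin n)) = n := by simp
  have hT : ∀ v : EuclideanSpace ℝ (Fin n), ‖v‖ = 1 → ‖T v‖ ≤ m * (n * c) := by
    intro v hv
    have hi : ∀ i, |T v i| ≤ n * c := by
      intro i
      have : T v i = ∑ j, A i j * v j := rfl
      rw [this]
      refine (Finset.abs_sum_le_sum_abs _ _).trans ?_
      calc ∑ j, |A i j * v j| ≤ ∑ _j : Fin n, c := by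
            refine Finset.sum_le_sum fun j _ => ?_
            rw [abs_mul]
            calc |A i j| * |v j| ≤ c * 1 := by
                  refine mul_le_mul (hA i j) (hv ▸ abs_apply_le_norm v j) (abs_nonneg _) ?_
                  exact (abs_nonneg _).trans (hA i j)
              _ = c := mul_one c
        _ = n * c := by simp
    calc ‖T v‖ = ‖∑ i, T v i • EuclideanSpace.basisFun (Fin m) ℝ i‖ := by
          conv_lhs => rw [← (EuclideanSpace.basisFun (Fin m) ℝ).sum_repr (T v)]
          simp only [EuclideanSpace.basisFun_repr]
      _ ≤ ∑ i, ‖T v i • EuclideanSpace.basisFun (Fin m) ℝ i‖ := norm_sum_le _ _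
      _ ≤ ∑ _i : Fin m, n * c := by
          refine Finset.sum_le_sum fun i _ => ?_
          rw [norm_smul, OrthonormalBasis.norm_eq_one, mul_one]
          exact hi i
      _ = m * (n * c) := by simp
  calc nuclearNorm A ≤ ∑ _i : Fin n, (m : ℝ) * (n * c) := by
        refine Finset.sum_le_sum fun i _ => ?_
        rw [singularValues_eq_norm_apply _ hn i]
        exact hT _ (OrthonormalBasis.norm_eq_one _ _)
    _ = _ := by simp

/-! ### Paired perturbations of the uniform distribution -/

theorem sum_fin_eq_sum_pairs {k m : ℕ} (h : k = m * 2) (f : Fin k → ℝ) :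
    ∑ x, f x = ∑ i : Fin m, (f ⟨2 * i, by omega⟩ + f ⟨2 * i + 1, by omega⟩) := by
  subst h
  rw [← finProdFinEquiv.sum_comp, Fintype.sum_prod_type]
  refine Finset.sum_congr rfl fun i _ => ?_
  rw [Fin.sum_univ_two]
  congr 2 <;> ext <;> simp [finProdFinEquiv, add_comm]

theorem uniform_apply {k : ℕ} [NeZero k] (x : Fin k) : uniform k x = 1 / k := by
  have : uniform k x = ((Fintype.card (Fin k) : ℕ) : ℝ)⁻¹ := rfl
  rw [this, Fintype.card_fin, one_div]

section

variable {k : ℕ}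

/-- The deviation `±β z_i / k` from the uniform distribution, the `i`-th pair of consecutive inputs
receiving opposite signs. -/
noncomputable def pairDeviation (hk : Even k) (β : ℝ) (z : EuclideanSpace ℝ (Fin (k / 2)))
    (x : Fin k) : ℝ :=
  (if (x : ℕ) % 2 = 0 then β / k else -(β / k)) *
    z ⟨x / 2, by obtain ⟨r, hr⟩ := hk; omega⟩

theorem pairDeviation_even (hk : Even k) (β : ℝ) (z : EuclideanSpace ℝ (Fin (k / 2)))
    (i : Fin (k / 2)) : pairDeviation hk β z ⟨2 * i, by omega⟩ = β / k * z i := by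
  simp [pairDeviation]

theorem pairDeviation_odd (hk : Even k) (β : ℝ) (z : EuclideanSpace ℝ (Fin (k / 2)))
    (i : Fin (k / 2)) : pairDeviation hk β z ⟨2 * i + 1, by omega⟩ = -(β / k * z i) := by
  have h : (2 * (i : ℕ) + 1) / 2 = i := by omega
  simp [pairDeviation, h, Nat.add_mod]

theorem sum_pairDeviation_mul (hk : Even k) (β : ℝ) (z : EuclideanSpace ℝ (Fin (k / 2)))
    (f : Fin k → ℝ) : ∑ x, pairDeviation hk β z x * f x =
      β / k * ∑ i : Fin (k / 2), z i * (f ⟨2 * i, by omega⟩ - f ⟨2 * i + 1, by omega⟩) := by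
  rw [sum_fin_eq_sum_pairs (Nat.div_two_mul_two_of_even hk).symm, Finset.mul_sum]
  refine Finset.sum_congr rfl fun i _ => ?_
  rw [pairDeviation_even, pairDeviation_odd]
  ring

theorem abs_pairDeviation_le (hk : Even k) {β : ℝ} (hβ0 : 0 ≤ β) (hβ1 : β ≤ 1)
    {z : EuclideanSpace ℝ (Fin (k / 2))} (hz : ∀ i, |z i| ≤ 1) (x : Fin k) :
    |pairDeviation hk β z x| ≤ 1 / k := by
  have h : |if (x : ℕ) % 2 = 0 then β / k else -(β / k)| ≤ 1 / (k : ℝ) := by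
    have : β / k ≤ 1 / (k : ℝ) := by gcongr
    split_ifs
    · rwa [abs_of_nonneg (by positivity)]
    · rwa [abs_neg, abs_of_nonneg (by positivity)]
  rw [pairDeviation, abs_mul]
  calc _ ≤ 1 / (k : ℝ) * 1 := mul_le_mul h (hz _) (abs_nonneg _) (by positivity)
    _ = 1 / k := mul_one _

variable [NeZero k]

/-- The perturbation of the uniform distribution by `pairDeviation`. -/
noncomputable def pairDistribution (hk : Even k) {β : ℝ} (hβ0 : 0 ≤ β) (hβ1 : β ≤ 1)
    {z : EuclideanSpace ℝ (Fin (k / 2))} (hz : ∀ i, |z i| ≤ 1) : Distribution (Fin k) :=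
  ⟨fun x => 1 / k + pairDeviation hk β z x, by
    refine ⟨fun x => ?_, ?_⟩
    · have := neg_abs_le (pairDeviation hk β z x)
      have := abs_pairDeviation_le hk hβ0 hβ1 hz x
      linarith
    · have h := sum_pairDeviation_mul hk β z fun _ => 1
      simp only [mul_one, sub_self, mul_zero, Finset.sum_const_zero] at h
      have hk0 : (k : ℝ) ≠ 0 := by exact_mod_cast NeZero.ne k
      rw [Finset.sum_add_distrib, h]
      simp [hk0]⟩

theorem pairDistribution_apply (hk : Even k) {β : ℝ} (hβ0 : 0 ≤ β) (hβ1 : β ≤ 1)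
    {z : EuclideanSpace ℝ (Fin (k / 2))} (hz : ∀ i, |z i| ≤ 1) (x : Fin k) :
    pairDistribution hk hβ0 hβ1 hz x = 1 / k + pairDeviation hk β z x := rfl

theorem tvDist_pairDistribution (hk : Even k) {β : ℝ} (hβ0 : 0 ≤ β) (hβ1 : β ≤ 1)
    {z : EuclideanSpace ℝ (Fin (k / 2))} (hz : ∀ i, |z i| ≤ 1) :
    tvDist (pairDistribution hk hβ0 hβ1 hz) (uniform k) = β / k * ∑ i, |z i| := by
  simp only [tvDist, pairDistribution_apply, uniform_apply, add_sub_cancel_left]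
  rw [sum_fin_eq_sum_pairs (Nat.div_two_mul_two_of_even hk).symm, Finset.mul_sum, Finset.mul_sum]
  refine Finset.sum_congr rfl fun i _ => ?_
  rw [pairDeviation_even, pairDeviation_odd, abs_neg, abs_mul, abs_of_nonneg (by positivity)]
  ring

end

/-! ### The channel matrix as a correlation form -/

section

variable {k : ℕ} {Y : Type*} [Fintype Y]

/-- The pairwise difference of output probabilities, tested against `z`. -/
noncomputable def pairDifference (W : Channel (Fin k) Y) (z : EuclideanSpace ℝ (Fin (k / 2)))
    (y : Y) : ℝ :=
  ∑ i : Fin (k / 2), z i * (W ⟨2 * i, by omega⟩ y - W ⟨2 * i + 1, by omega⟩ y)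

theorem inner_channelMatrix (W : Channel (Fin k) Y) (z z' : EuclideanSpace ℝ (Fin (k / 2))) :
    ⟪Matrix.toEuclideanLin (channelMatrix W) z, z'⟫_ℝ =
      ∑ y, pairDifference W z y * pairDifference W z' y / ∑ x, W x y := by
  set a : Fin (k / 2) → Y → ℝ :=
    fun i y => W ⟨2 * i, by omega⟩ y - W ⟨2 * i + 1, by omega⟩ y with ha
  have hl : ∀ i, Matrix.toEuclideanLin (channelMatrix W) z i =
      ∑ j, (∑ y, a i y * a j y / ∑ x, W x y) * z j := fun i => rfl
  have hd : ∀ (v : EuclideanSpace ℝ (Fin (k / 2))) y, pairDifference W v y = ∑ i, v i * a i y :=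
    fun v y => rfl
  simp only [PiLp.inner_apply, RCLike.inner_apply, conj_trivial, hl, hd]
  calc ∑ i, z' i * ∑ j, (∑ y, a i y * a j y / ∑ x, W x y) * z j
      = ∑ i, ∑ j, ∑ y, z j * a j y * (z' i * a i y) / ∑ x, W x y := by
        simp only [Finset.mul_sum, Finset.sum_mul]
        refine Finset.sum_congr rfl fun i _ => Finset.sum_congr rfl fun j _ =>
          Finset.sum_congr rfl fun y _ => by ring
    _ = ∑ y, ∑ i, ∑ j, z j * a j y * (z' i * a i y) / ∑ x, W x y := by
        rw [Finset.sum_comm]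
        rw [Finset.sum_congr rfl fun i _ => Finset.sum_comm, Finset.sum_comm]
        exact Finset.sum_congr rfl fun y _ => Finset.sum_comm
    _ = _ := by
        refine Finset.sum_congr rfl fun y _ => ?_
        rw [Finset.sum_comm, Finset.sum_mul_sum, Finset.sum_div]
        exact Finset.sum_congr rfl fun i _ => (Finset.sum_div _ _ _).symm

theorem isPositive_channelMatrix (W : Channel (Fin k) Y) :
    (Matrix.toEuclideanLin (channelMatrix W)).IsPositive := by
  refine ⟨fun z z' => ?_, fun z => ?_⟩
  · rw [inner_channelMatrix, real_inner_comm, inner_channelMatrix]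
    simp_rw [mul_comm]
  · simp only [RCLike.re_to_real]
    rw [inner_channelMatrix]
    refine Finset.sum_nonneg fun y _ => div_nonneg (mul_self_nonneg _) ?_
    exact Finset.sum_nonneg fun x _ => (W x).2.1 y

theorem abs_channelMatrix_le (W : Channel (Fin k) Y) (i j : Fin (k / 2)) :
    |channelMatrix W i j| ≤ Fintype.card Y := by
  have h0 : ∀ x y, 0 ≤ W x y := fun x y => (W x).2.1 y
  have h1 : ∀ x y, W x y ≤ 1 := fun x y => (mem_Icc_of_mem_stdSimplex (W x).2 y).2
  have hS : ∀ x y, W x y ≤ ∑ x, W x y := fun x y =>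
    Finset.single_le_sum (f := fun x => W x y) (fun x _ => h0 x y) (Finset.mem_univ x)
  rw [channelMatrix, Matrix.of_apply]
  refine (Finset.abs_sum_le_sum_abs _ _).trans ?_
  calc _ ≤ ∑ _y : Y, (1 : ℝ) := by
        refine Finset.sum_le_sum fun y _ => ?_
        have hS0 : 0 ≤ ∑ x, W x y := Finset.sum_nonneg fun x _ => h0 x y
        rw [abs_div, abs_mul, abs_of_nonneg hS0]
        refine div_le_one_of_le₀ ?_ hS0
        rw [← mul_one (∑ x, W x y)]
        refine mul_le_mul ?_ ?_ (abs_nonneg _) hS0 <;> rw [abs_le] <;> constructor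
        · linarith [h0 ⟨2 * i, by omega⟩ y, hS ⟨2 * i + 1, by omega⟩ y]
        · linarith [h0 ⟨2 * i + 1, by omega⟩ y, hS ⟨2 * i, by omega⟩ y]
        · linarith [h0 ⟨2 * j, by omega⟩ y, h1 ⟨2 * j + 1, by omega⟩ y]
        · linarith [h0 ⟨2 * j + 1, by omega⟩ y, h1 ⟨2 * j, by omega⟩ y]
    _ = Fintype.card Y := by simp

theorem nuclearNorm_le_supNuclearNorm {𝒲 : Set (Channel (Fin k) Y)} (W : 𝒲) :
    nuclearNorm (channelMatrix (W : Channel (Fin k) Y)) ≤ supNuclearNorm 𝒲 := by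
  refine le_ciSup (f := fun W : 𝒲 => nuclearNorm (channelMatrix (W : Channel (Fin k) Y))) ?_ W
  refine ⟨(k / 2 : ℕ) * ((k / 2 : ℕ) * ((k / 2 : ℕ) * Fintype.card Y)), ?_⟩
  rintro _ ⟨W, rfl⟩
  exact nuclearNorm_le_of_abs_le (abs_channelMatrix_le (W : Channel (Fin k) Y))

variable [NeZero k]

theorem outputProb_uniform (W : Channel (Fin k) Y) (y : Y) :
    outputProb W (uniform k) y = (∑ x, W x y) / k := by
  simp only [outputProb, uniform_apply, ← Finset.mul_sum]
  ring

theorem outputProb_pairDistribution_sub (hk : Even k) {β : ℝ} (hβ0 : 0 ≤ β) (hβ1 : β ≤ 1)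
    {z : EuclideanSpace ℝ (Fin (k / 2))} (hz : ∀ i, |z i| ≤ 1) (W : Channel (Fin k) Y) (y : Y) :
    outputProb W (pairDistribution hk hβ0 hβ1 hz) y - outputProb W (uniform k) y =
      β / k * pairDifference W z y := by
  rw [pairDifference, ← sum_pairDeviation_mul hk β z fun x => W x y, outputProb, outputProb,
    ← Finset.sum_sub_distrib]
  refine Finset.sum_congr rfl fun x _ => ?_
  rw [pairDistribution_apply, uniform_apply]
  ring

/-- The perturbation of the output law is linear in `z`, so its correlations form a bilinear form,
whose matrix is `H(W)` up to scale. -/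
theorem inducedCorrelation_pairDistribution (hk : Even k) {β : ℝ} (hβ0 : 0 ≤ β) (hβ1 : β ≤ 1)
    {z z' : EuclideanSpace ℝ (Fin (k / 2))} (hz : ∀ i, |z i| ≤ 1) (hz' : ∀ i, |z' i| ≤ 1)
    (W : Channel (Fin k) Y) :
    inducedCorrelation W (uniform k) (pairDistribution hk hβ0 hβ1 hz)
      (pairDistribution hk hβ0 hβ1 hz') =
      β ^ 2 / k * ⟪Matrix.toEuclideanLin (channelMatrix W) z, z'⟫_ℝ := by
  have hk0 : (k : ℝ) ≠ 0 := by exact_mod_cast NeZero.ne k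
  rw [inner_channelMatrix, Finset.mul_sum, inducedCorrelation]
  refine Finset.sum_congr rfl fun y _ => ?_
  rw [inducedPerturbation, inducedPerturbation, outputProb_pairDistribution_sub,
    outputProb_pairDistribution_sub, outputProb_uniform]
  -- An output of probability zero contributes `0` on both sides, by the convention for division by
  -- zero.
  rcases eq_or_ne (∑ x, W x y) 0 with h | h
  · simp [h]
  · field_simp

end

/-! ### Assembly -/

/-- For every `n`-tuple of channels there is an almost `ε`-perturbation around the uniform
distribution of small decoupled chi-square fluctuation. -/
theorem exists_decoupledFluctuation_le {k : ℕ} [NeZero k] (hk : Even k) {Y : Type*} [Fintype Y]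
    {n : ℕ} (W : Fin n → Channel (Fin k) Y) {s ε₀ ε : ℝ}
    (hs : ∀ i, nuclearNorm (channelMatrix (W i)) ≤ s) (hε₀ : 0 < ε₀) (hε₀' : ε₀ < 1 / 2)
    (hε : 0 < ε) (hεε₀ : ε ≤ ε₀) :
    ∃ P : WeightedFamily (Fin k), P.IsAlmostPerturbation (uniform k) ε ∧
      decoupledFluctuation (uniform k) W P ≤
        2 / (((1 - 2 * ε₀) / 3) ^ 3 * ε₀ ^ 4) * ((n : ℝ) ^ 2 * ε ^ 4 / (k : ℝ) ^ 3 * s ^ 2) := by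
  have hkpos : 0 < k := Nat.pos_of_ne_zero (NeZero.ne k)
  have hmk : k / 2 * 2 = k := Nat.div_two_mul_two_of_even hk
  have hm : 0 < k / 2 := by omega
  have hmR : (0 : ℝ) < (k / 2 : ℕ) := by exact_mod_cast hm
  have hkR : (k : ℝ) = (k / 2 : ℕ) * 2 := by exact_mod_cast hmk.symm
  -- Chosen so that `(1 - 3η) m = ε₀ k`, which the scaling `ε / ε₀` turns into total variation at
  -- least `ε`.
  set η := (1 - 2 * ε₀) / 3 with hηdef
  have hη : 0 < η := by rw [hηdef]; linarith
  have hη3 : η < 1 / 3 := by rw [hηdef]; linarith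
  set T : EuclideanSpace ℝ (Fin (k / 2)) →ₗ[ℝ] EuclideanSpace ℝ (Fin (k / 2)) :=
    ∑ i, Matrix.toEuclideanLin (channelMatrix (W i)) with hTdef
  have hinner : ∀ z z', ⟪T z, z'⟫_ℝ =
      ∑ i, ⟪Matrix.toEuclideanLin (channelMatrix (W i)) z, z'⟫_ℝ := by
    intro z z'
    rw [hTdef, LinearMap.sum_apply, sum_inner]
  have hT : T.IsPositive := LinearMap.isPositive_sum _ fun i _ => isPositive_channelMatrix (W i)
  have htr : LinearMap.trace ℝ _ T ≤ n * s := by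
    rw [hTdef, map_sum]
    calc _ ≤ ∑ _i : Fin n, s := Finset.sum_le_sum fun i _ =>
          (trace_toEuclideanLin_le_nuclearNorm _).trans (hs i)
      _ = n * s := by simp
  obtain ⟨Q, hQ, hTQ⟩ := exists_finrank_le_norm_apply_le hT htr (mul_pos hη hmR)
  obtain ⟨Z, hZ, w, x, hw, hw1, hxQ, hx1, hexp, hprob⟩ := exists_partialColoring hm hη hη3 Q hQ
  have hβ0 : 0 ≤ ε / ε₀ := by positivity
  have hβ1 : ε / ε₀ ≤ 1 := (div_le_one hε₀).mpr hεε₀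
  refine ⟨⟨Z, fun z => pairDistribution hk hβ0 hβ1 (hx1 z), ⟨w, hw, hw1⟩⟩, ⟨1 / 10, le_rfl, ?_⟩, ?_⟩
  · refine hprob.trans ?_
    refine Finset.sum_le_sum_of_subset_of_nonneg ?_ fun z _ _ => hw z
    intro z hz
    have hz1 := (Finset.mem_filter.mp hz).2
    refine Finset.mem_filter.mpr ⟨Finset.mem_univ _, ?_⟩
    rw [tvDist_pairDistribution]
    have h1 : (1 - 3 * η) * (k / 2 : ℕ) = ε₀ * k := by rw [hkR, hηdef]; ring
    rw [h1] at hz1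
    have hk0 : (0 : ℝ) < k := by exact_mod_cast hkpos
    calc ε = ε / ε₀ / k * (ε₀ * k) := by field_simp
      _ ≤ _ := by gcongr
  · have hsum := sum_sum_exp_inner_le (T := T) (l := (ε / ε₀) ^ 2 / k) (by positivity) hw hw1 hx1
      hexp (fun z => hTQ _ (hxQ z))
    -- One factor `1 / η` is the subgaussian constant, two come from the norm of `T` off `Q`; the
    -- `2` in the final constant comes from `m = k / 2`.
    set B := 1 / η * ((ε / ε₀) ^ 2 / k) ^ 2 * (n * s / (η * (k / 2 : ℕ))) ^ 2 * (k / 2 : ℕ) with hB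
    have hBeq : B = 2 / (η ^ 3 * ε₀ ^ 4) * ((n : ℝ) ^ 2 * ε ^ 4 / (k : ℝ) ^ 3 * s ^ 2) := by
      rw [hB, hkR]
      field_simp
    rw [← hBeq]
    have hB0 : 0 ≤ B := by positivity
    have heq : decoupledFluctuation (uniform k) W
        ⟨Z, fun z => pairDistribution hk hβ0 hβ1 (hx1 z), ⟨w, hw, hw1⟩⟩ =
        Real.log (∑ z, ∑ z', w z * w z' * Real.exp ((ε / ε₀) ^ 2 / k * ⟪T (x z), x z'⟫_ℝ)) := by
      unfold decoupledFluctuation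
      congr 1
      refine Finset.sum_congr rfl fun z _ => Finset.sum_congr rfl fun z' _ => ?_
      simp_rw [inducedCorrelation_pairDistribution]
      rw [hinner, Finset.mul_sum]
      rfl
    rw [heq]
    have hnn : 0 ≤ ∑ z, ∑ z', w z * w z' * Real.exp ((ε / ε₀) ^ 2 / k * ⟪T (x z), x z'⟫_ℝ) :=
      Finset.sum_nonneg fun z _ => Finset.sum_nonneg fun z' _ =>
        mul_nonneg (mul_nonneg (hw z) (hw z')) (Real.exp_nonneg _)
    rcases hnn.eq_or_lt with h0 | h0
    · rwa [← h0, Real.log_zero]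
    · exact (Real.log_le_iff_le_exp h0).mpr hsum

end InformationConstraints

open InformationConstraints

theorem mainTheorem3 :
    ∃ C : ℝ, 0 < C ∧ ∀ ε₀ : ℝ, 0 < ε₀ → ε₀ < 1 / 2 → ∃ K : ℝ, 0 < K ∧
      ∀ (k : ℕ) [NeZero k], Even k →
      ∀ (Y : Type*) [Fintype Y] (𝒲 : Set (Channel (Fin k) Y)) (n : ℕ) (ε : ℝ),
        0 < ε → ε ≤ ε₀ →
        (n : ℝ) * (ε ^ 2 * supNuclearNorm 𝒲) ≤ C * (k : ℝ) ^ (3 / 2 : ℝ) →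
        maxminFluctuation (uniform k) 𝒲 n ε ≤
          ((K * ((n : ℝ) ^ 2 * ε ^ 4 / (k : ℝ) ^ 3 * supNuclearNorm 𝒲 ^ 2) : ℝ) : EReal) := by
  refine ⟨1, one_pos, fun ε₀ hε₀ hε₀' => ⟨2 / (((1 - 2 * ε₀) / 3) ^ 3 * ε₀ ^ 4), ?_, ?_⟩⟩
  · have : 0 < (1 - 2 * ε₀) / 3 := by linarith
    positivity
  · intro k _ hk Y _ 𝒲 n ε hε hεε₀ _
    refine iSup_le fun W => ?_
    obtain ⟨P, hP, hle⟩ := exists_decoupledFluctuation_le hk (fun i => (W i : Channel (Fin k) Y))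
      (fun i => nuclearNorm_le_supNuclearNorm (W i)) hε₀ hε₀' hε hεε₀
    exact (iInf₂_le P hP).trans (EReal.coe_le_coe_iff.mpr hle)
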